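/- Let $\Bbbk$ be an algebraically closed field, $G$ a finite group, $n\ge 0$, and let $H=\Bbbk[G]$ be the algebra of all functions $G\to\Bbbk$, with left shifts $(L_gf)(x)=f(gx)$ and basis $T_g$ $(g\in G)$, $T_g(\gamma)=\delta_{g,\gamma}$. Let $M_n=H\otimes\Bbbk^n$ be the free $H$-module of rank $n$. Let $\mathrm{Cend}_n=\mathrm{Cend}_n^{G,G}$ be the space of all maps $a:G\to\mathrm{End}_{\Bbbk}M_n$ such that $a(g)(fu)=(L_gf)\,(a(g)u)$ for all $g\in G$, $f\in H$, $u\in M_n$. It is a conformal algebra over $G$ with the $H$-module structure $(fa)(g)=f(g^{-1})a(g)$ and the products $(a\circ_g b)(z)=a(g)b(zg^{-1})$, $g,z\in G$, and it is identified with $H\otimes H\otimes \mathbb M_n(\Bbbk)$ by letting $h\otimes f\otimes A$ be the map $z\mapsto h(z^{-1})\,f\,L_z\otimes A$. A conformal subalgebra is an $H$-submodule closed under all products $\circ_g$; an automorphism of $\mathrm{Cend}_n$ is an $H$-linear bijection preserving all products $\circ_g$. A conformal subalgebra $C\subseteq\mathrm{Cend}_n$ is irreducible if $C\neq 0$ and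 $M_n$ has no $H$-submodules invariant under all operators $a(g)$, $a\in C$, $g\in G$, except for $\{0\}$ and $M_n$. Let $C$ be an irreducible conformal subalgebra of $\mathrm{Cend}_n$. Then there exist an automorphism $\theta$ of the conformal algebra $\mathrm{Cend}_n$, a subgroup $G_1$ of $G$ with left cosets $\{gG_1\mid g\in G\}=\{G_1,\dots,G_p\}$, and a function $\chi:G\times G\to\Bbbk^*$ such that for all $g,h\in G$ and $k\in\{1,\dots,p\}$ the value $$\frac{\chi(g,\gamma)\,\chi(h,g^{-1}\gamma)}{\chi(gh,\gamma)}\in\Bbbk^*$$ does not depend on the choice of $\gamma\in G_k$, and $\theta(C)=C_{G_1,\chi}$, where $$C_{G_1,\chi}=\Big\{\sum_{g\in G}T_g\otimes\sum_{k=1}^p\sum_{\alpha\in G_k}T_\alpha\otimes\chi(g,\alpha)\,a_{g,k}\ \Big|\ a_{g,k}\in\mathbb M_n(\Bbbk)\Big\}.$$ -/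

import Mathlib

namespace FiniteConformal

variable (k G : Type*) [Field k]

/-- The coordinate algebra `H = k[G]` of a finite group `G`, viewed as a linear algebraic group
over `k`: the algebra of all functions `G → k` with pointwise operations. -/
abbrev H : Type _ := G → k

/-- The regular functions on `G` with values in a vector space `N`: those of the form
`g ↦ ∑ hᵢ(g) vᵢ`, a finite sum with `hᵢ ∈ H` and `vᵢ ∈ N` (the image of `H ⊗ N`). -/
def regularMaps (N : Type*) [AddCommGroup N] [Module k N] : Submodule k (G → N) :=
  Submodule.span k (Set.range fun p : H k G × N => fun g => p.1 g • p.2)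

theorem mem_regularMaps [Finite G] {N : Type*} [AddCommGroup N] [Module k N] (f : G → N) :
    f ∈ regularMaps k G N := by
  classical
  have := Fintype.ofFinite G
  have hf : f = ∑ x : G, fun g => (Pi.single x (1 : k) : H k G) g • f x := by
    funext g
    simp [Finset.sum_apply, Pi.single_apply]
  rw [hf]
  exact Submodule.sum_mem _ fun x _ => Submodule.subset_span ⟨(Pi.single x 1, f x), rfl⟩

variable {k G} [Group G]

/-- The left shift `(L_g f)(x) = f(g x)`. -/
def leftShift (g : G) (f : H k G) : H k G := fun x => f (g * x)

variable (k G)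

/-- A conformal algebra over the finite group `G`: an `H`-module with bilinear products
`(a ∘_g b)`, `g ∈ G`, that are regular in `g` and satisfy `(h a ∘_g b) = h(g⁻¹) (a ∘_g b)` and
`(a ∘_g h b) = (L_g h) (a ∘_g b)`. -/
class ConformalAlgebra (C : Type*) [AddCommGroup C] [Module k C] [Module (H k G) C]
    [IsScalarTower k (H k G) C] where
  /-- the product `a ∘_g b` -/
  prod : G → C →ₗ[k] C →ₗ[k] C
  prod_regular : ∀ a b : C, (fun g => prod g a b) ∈ regularMaps k G C
  smul_prod : ∀ (g : G) (h : H k G) (a b : C), prod g (h • a) b = h g⁻¹ • prod g a b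
  prod_smul : ∀ (g : G) (h : H k G) (a b : C),
    prod g a (h • b) = leftShift g h • prod g a b

/-- A conformal subalgebra: an `H`-submodule closed under all products. -/
structure ConformalSubalgebra (C : Type*) [AddCommGroup C] [Module k C] [Module (H k G) C]
    [IsScalarTower k (H k G) C] [ConformalAlgebra k G C] extends Submodule (H k G) C where
  prod_mem : ∀ (g : G) {a b : C}, a ∈ carrier → b ∈ carrier →
    ConformalAlgebra.prod (k := k) g a b ∈ carrier

/-- An automorphism of a conformal algebra: an `H`-linear bijection preserving all products. -/
structure ConformalAut (C : Type*) [AddCommGroup C] [Module k C] [Module (H k G) C]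
    [IsScalarTower k (H k G) C] [ConformalAlgebra k G C] extends C ≃ₗ[H k G] C where
  map_prod : ∀ (g : G) (a b : C), toLinearEquiv (ConformalAlgebra.prod (k := k) g a b) =
    ConformalAlgebra.prod (k := k) g (toLinearEquiv a) (toLinearEquiv b)

/-- The free `H`-module `M_n` of rank `n`; `u : M_n` is the vector-valued function on `G`
with coordinates `u i : G → k`. -/
abbrev FreeMod (n : ℕ) : Type _ := Fin n → H k G

/-- Conformal endomorphisms of `M_n`: locally regular maps `a : G → End_k M_n` that are
translation invariant, `a(g)(f u) = (L_g f)(a(g) u)`. -/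
def cendSubmodule (n : ℕ) : Submodule k (G → Module.End k (FreeMod k G n)) where
  carrier := {a | (∀ u, (fun g => a g u) ∈ regularMaps k G (FreeMod k G n)) ∧
    ∀ (g : G) (f : H k G) (u : FreeMod k G n), a g (f • u) = leftShift g f • a g u}
  add_mem' := by
    rintro a b ⟨ha, ha'⟩ ⟨hb, hb'⟩
    refine ⟨fun u => Submodule.add_mem _ (ha u) (hb u), fun g f u => ?_⟩
    simp [ha', hb', smul_add]
  zero_mem' := ⟨fun u => Submodule.zero_mem _, fun g f u => by simp⟩
  smul_mem' := by
    rintro c a ⟨ha, ha'⟩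
    refine ⟨fun u => Submodule.smul_mem _ c (ha u), fun g f u => ?_⟩
    simp [ha', smul_comm c]

/-- `Cend_n = Cend_n^{G,G}`, the space of conformal endomorphisms of `M_n`. -/
def Cend (n : ℕ) : Type _ := ↥(cendSubmodule k G n)

namespace Cend

variable {k G} {n : ℕ}

instance : AddCommGroup (Cend k G n) := inferInstanceAs (AddCommGroup ↥(cendSubmodule k G n))

instance : Module k (Cend k G n) := inferInstanceAs (Module k ↥(cendSubmodule k G n))

/-- The operator `a(g) ∈ End_k M_n`. -/
def op (a : Cend k G n) (g : G) : Module.End k (FreeMod k G n) := a.1 g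

theorem ext_op {a b : Cend k G n} (h : ∀ g u, a.op g u = b.op g u) : a = b :=
  Subtype.ext (funext fun g => LinearMap.ext (h g))

theorem op_add (a b : Cend k G n) (g : G) : (a + b).op g = a.op g + b.op g := rfl

theorem op_zero (g : G) : (0 : Cend k G n).op g = 0 := rfl

theorem op_smul (c : k) (a : Cend k G n) (g : G) : (c • a).op g = c • a.op g := rfl

theorem op_tinv (a : Cend k G n) (g : G) (f : H k G) (u : FreeMod k G n) :
    a.op g (f • u) = leftShift g f • a.op g u := a.2.2 g f u

variable [Finite G]

/-- Build a conformal endomorphism; local regularity is automatic over a finite group. -/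
def mk (a : G → Module.End k (FreeMod k G n))
    (ha : ∀ (g : G) (f : H k G) (u : FreeMod k G n), a g (f • u) = leftShift g f • a g u) :
    Cend k G n :=
  ⟨a, fun _ => mem_regularMaps k G _, ha⟩

/-- The `H`-module structure `(f a)(g) = f(g⁻¹) a(g)`. -/
instance : SMul (H k G) (Cend k G n) where
  smul f a := mk (fun g => f g⁻¹ • a.op g) fun g h u => by
    simp [op_tinv, smul_comm (f g⁻¹)]

theorem op_hsmul (f : H k G) (a : Cend k G n) (g : G) :
    (f • a).op g = f g⁻¹ • a.op g := rfl

instance : Module (H k G) (Cend k G n) where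
  one_smul a := ext_op fun g u => by simp [op_hsmul]
  mul_smul f h a := ext_op fun g u => by simp [op_hsmul, mul_smul]
  smul_zero f := ext_op fun g u => by simp [op_hsmul, op_zero]
  smul_add f a b := ext_op fun g u => by simp [op_hsmul, op_add]
  add_smul f h a := ext_op fun g u => by simp [op_hsmul, op_add, add_smul]
  zero_smul a := ext_op fun g u => by simp [op_hsmul, op_zero]

instance : IsScalarTower k (H k G) (Cend k G n) where
  smul_assoc c f a := ext_op fun g u => by simp [op_hsmul, op_smul, mul_smul]

/-- The product `(a ∘_g b)(z) = a(g) b(z g⁻¹)`. -/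
def prod (g : G) (a b : Cend k G n) : Cend k G n :=
  mk (fun z => a.op g * b.op (z * g⁻¹)) fun z f u => by
    have h : leftShift g (leftShift (z * g⁻¹) f) = leftShift z f := by
      funext x
      simp [leftShift, mul_assoc]
    simp [op_tinv, h]

theorem op_prod (g : G) (a b : Cend k G n) (z : G) :
    (prod g a b).op z = a.op g * b.op (z * g⁻¹) := rfl

instance : ConformalAlgebra k G (Cend k G n) where
  prod g := LinearMap.mk₂ k (prod g)
    (fun a b c => ext_op fun z u => by simp [op_prod, op_add])
    (fun r a b => ext_op fun z u => by simp [op_prod, op_smul])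
    (fun a b c => ext_op fun z u => by simp [op_prod, op_add])
    (fun r a b => ext_op fun z u => by simp [op_prod, op_smul])
  prod_regular _ _ := mem_regularMaps k G _
  smul_prod g h a b := ext_op fun z u => by simp [op_prod, op_smul, op_hsmul]
  prod_smul g h a b := ext_op fun z u => by
    simp [op_prod, op_hsmul, leftShift]

/-- The element of `Cend_n` identified with `h ⊗ f ⊗ A ∈ H ⊗ H ⊗ M_n(k)`: it is the map
`z ↦ h(z⁻¹) f L_z ⊗ A`. -/
def tmul (h f : H k G) (A : Matrix (Fin n) (Fin n) k) : Cend k G n :=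
  mk (fun z =>
    { toFun := fun u i x => h z⁻¹ * f x * ∑ j, A i j * u j (z * x)
      map_add' := fun u v => by
        funext i x
        simp [mul_add, Finset.sum_add_distrib]
      map_smul' := fun c u => by
        funext i x
        simp only [Pi.smul_apply, smul_eq_mul, RingHom.id_apply, Finset.mul_sum]
        exact Finset.sum_congr rfl fun j _ => by ring })
    fun z f' u => by
      funext i x
      simp only [LinearMap.coe_mk, AddHom.coe_mk, Pi.smul_apply, smul_eq_mul, Pi.mul_apply,
        leftShift, Finset.mul_sum]
      exact Finset.sum_congr rfl fun j _ => by ring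

end Cend

variable {k G} {n : ℕ} [Finite G]

/-- `W_n(C)`, the linear span of all operators `a(g)`, `a ∈ C`, `g ∈ G`. -/
def operatorSpan (C : ConformalSubalgebra k G (Cend k G n)) :
    Submodule k (Module.End k (FreeMod k G n)) :=
  Submodule.span k {w | ∃ a ∈ C.toSubmodule, ∃ g : G, w = a.op g}

/-- `C` is irreducible: `C` is nonzero, and `M_n` has no `W_n(C)`-invariant `H`-submodules
except for `{0}` and `M_n`. -/
def IsIrreducible (C : ConformalSubalgebra k G (Cend k G n)) : Prop :=
  C.toSubmodule ≠ ⊥ ∧ ∀ N : Submodule (H k G) (FreeMod k G n),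
    (∀ w ∈ operatorSpan C, ∀ u ∈ N, w u ∈ N) → N = ⊥ ∨ N = ⊤

/-- For all `g, h`, the value `χ(g,γ) χ(h,g⁻¹γ) / χ(gh,γ)` depends only on the left coset
`γ G₁`. -/
def CosetCocycle (G₁ : Subgroup G) (χ : G → G → kˣ) : Prop :=
  ∀ g h γ γ' : G, (γ : G ⧸ G₁) = (γ' : G ⧸ G₁) →
    χ g γ * χ h (g⁻¹ * γ) / χ (g * h) γ = χ g γ' * χ h (g⁻¹ * γ') / χ (g * h) γ'

/-- `C_{G₁,χ}`: all elements
`∑_{g ∈ G} T_g ⊗ ∑_{K ∈ G/G₁} ∑_{α ∈ K} T_α ⊗ χ(g,α) a_{g,K}` with matrices `a_{g,K}`, where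
`T_g = Pi.single g 1` is the indicator function of `g`. Summing over the cosets `K` and over
`α ∈ K` is summing over `α ∈ G` with `K` the coset of `α`. -/
def cosetAlgebra [Fintype G] [DecidableEq G] (G₁ : Subgroup G) (χ : G → G → kˣ) :
    Set (Cend k G n) :=
  {x | ∃ a : G → G ⧸ G₁ → Matrix (Fin n) (Fin n) k,
    x = ∑ g : G, ∑ α : G,
      Cend.tmul (Pi.single g 1) (Pi.single α 1) ((χ g α : k) • a g (α : G ⧸ G₁))}

end FiniteConformal

/-! Translation invariance gives `(a(g)u)(x) = A_g(x) u(gx)`, so `C` amounts to a family of spaces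
`S g` of matrix functions on `G`, closed under the twisted product `A(x)B(gx)`; `H`-linearity makes
the components independent (`mem_of_forall_coef_mem`). Irreducibility and Burnside's theorem show
that every evaluation of `S g` at a point is onto the matrix algebra (`IsMultiplicative.isFull`).

Since the matrix algebra is simple, two evaluations of `S 1` either have the same kernel or can be
separated (`exists_eq_one_eq_zero`). Having the same kernel is a left-invariant relation, so its
classes are the left cosets of a subgroup `G₁`. Inside a class the evaluations differ by an inner
automorphism (`Linked.exists_conj`); the conjugating matrices give a gauge transformation, an
automorphism of `Cend_n`, after which `S 1` consists of functions constant on cosets. The values of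
an element of `S g` on one coset are then proportional with universal factors
(`Linked.exists_scalar`). These factors are `χ`, and closure under products is the cocycle
condition. -/

namespace FiniteConformal

open Matrix

/-! ### Full matrix algebras: ideals, Burnside, Skolem–Noether. -/

section MatrixAlgebra

variable {k ι : Type*} [Field k] [Fintype ι] [DecidableEq ι]

/-- A nonzero two-sided ideal of a full matrix algebra is everything. -/
theorem eq_top_of_two_sided (I : Submodule k (Matrix ι ι k))
    (hl : ∀ X, ∀ A ∈ I, X * A ∈ I) (hr : ∀ X, ∀ A ∈ I, A * X ∈ I)
    {A : Matrix ι ι k} (hA : A ∈ I) (h0 : A ≠ 0) : I = ⊤ := by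
  obtain ⟨i, j, hij⟩ : ∃ i j, A i j ≠ 0 := by
    by_contra! h
    exact h0 (Matrix.ext h)
  have hs : ∀ p q, Matrix.single p q (1 : k) ∈ I := fun p q => by
    have h := I.smul_mem (A i j)⁻¹ (hr (Matrix.single j q 1) _ (hl (Matrix.single p i 1) _ hA))
    rw [single_mul_mul_single] at h
    simpa [hij] using h
  refine eq_top_iff.2 fun X _ => ?_
  rw [matrix_eq_sum_single X]
  refine I.sum_mem fun p _ => I.sum_mem fun q _ => ?_
  simpa using I.smul_mem (X p q) (hs p q)

/-- **Burnside's theorem** for a space of matrices closed under multiplication that acts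
transitively on nonzero vectors. -/
theorem eq_top_of_transitive [IsAlgClosed k] [Nonempty ι] (S : Submodule k (Matrix ι ι k))
    (hmul : ∀ A ∈ S, ∀ B ∈ S, A * B ∈ S)
    (htr : ∀ v : ι → k, v ≠ 0 → ∀ w, ∃ A ∈ S, A *ᵥ v = w) : S = ⊤ := by
  classical
  -- `S` is not known to contain 1, so density is applied to the unital algebra `R` generated by
  -- `S`, in which `S` is an ideal.
  let R : Subalgebra k (Module.End k (ι → k)) := Algebra.adjoin k (toLinAlgEquiv' '' S)
  have hsimple : IsSimpleModule R (ι → k) := by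
    refine { eq_bot_or_eq_top := fun N => ?_ }
    refine or_iff_not_imp_left.2 fun hN => ?_
    obtain ⟨v, hv, hv0⟩ := N.ne_bot_iff.1 hN
    refine eq_top_iff.2 fun w _ => ?_
    obtain ⟨A, hA, rfl⟩ := htr v hv0 w
    exact N.smul_mem (⟨toLinAlgEquiv' A, Algebra.subset_adjoin ⟨A, hA, rfl⟩⟩ : R) hv
  have hR : ∀ T : Module.End k (ι → k), T ∈ R := fun T => by
    -- By Schur's lemma the commutant of `R` is `k`, so density applies to every `k`-linear `T`.
    let f : Module.End (Module.End R (ι → k)) (ι → k) :=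
      { T with
        map_smul' := fun φ v => by
          obtain ⟨c, rfl⟩ :=
            (IsSimpleModule.algebraMap_end_bijective_of_isAlgClosed (A := R) (V := ι → k) k).2 φ
          exact T.map_smul c v }
    obtain ⟨r, hr⟩ := jacobson_density (R := R) f
      (Finset.univ.image fun i : ι => (Pi.single i 1 : ι → k))
    have hTr : T = r.1 := LinearMap.pi_ext' fun i => LinearMap.ext_ring <|
      hr (Pi.single i 1) (Finset.mem_image_of_mem _ (Finset.mem_univ i))
    exact hTr ▸ r.2
  have hl : ∀ X, ∀ A ∈ S, X * A ∈ S ∧ A * X ∈ S := fun X => by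
    have key : ∀ T ∈ R, ∀ A ∈ S, toLinAlgEquiv'.symm T * A ∈ S ∧
        A * toLinAlgEquiv'.symm T ∈ S := fun T hT => by
      induction hT using Algebra.adjoin_induction with
      | mem T hT =>
        obtain ⟨B, hB, rfl⟩ := hT
        intro A hA
        rw [AlgEquiv.symm_apply_apply]
        exact ⟨hmul B hB A hA, hmul A hA B hB⟩
      | algebraMap c =>
        intro A hA
        rw [AlgEquiv.commutes, ← Algebra.commutes, ← Algebra.smul_def]
        exact ⟨S.smul_mem c hA, S.smul_mem c hA⟩
      | add T U _ _ hT hU =>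
        intro A hA
        rw [map_add, add_mul, mul_add]
        exact ⟨S.add_mem (hT A hA).1 (hU A hA).1, S.add_mem (hT A hA).2 (hU A hA).2⟩
      | mul T U _ _ hT hU =>
        intro A hA
        rw [map_mul]
        exact ⟨by rw [mul_assoc]; exact (hT _ (hU A hA).1).1,
          by rw [← mul_assoc]; exact (hU _ (hT A hA).2).2⟩
    simpa using key (toLinAlgEquiv' X) (hR _)
  obtain ⟨A, hA, hA1⟩ := htr 1 one_ne_zero 1
  refine eq_top_of_two_sided S (fun X B hB => (hl X B hB).1) (fun X B hB => (hl X B hB).2) hA ?_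
  rintro rfl
  simp at hA1

/-- **Skolem–Noether** for full matrix algebras. -/
theorem exists_unit_conj (f : Matrix ι ι k ≃ₐ[k] Matrix ι ι k) :
    ∃ P : (Matrix ι ι k)ˣ, ∀ A, f A = P * A * (P⁻¹ : (Matrix ι ι k)ˣ) := by
  obtain ⟨T, hT⟩ := AlgEquiv.eq_linearEquivConjAlgEquiv
    ((toLinAlgEquiv'.symm.trans f).trans toLinAlgEquiv')
  refine ⟨Units.map (toLinAlgEquiv' (R := k) (n := ι)).symm.toMonoidHom
    (LinearMap.GeneralLinearGroup.ofLinearEquiv T), fun A => ?_⟩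
  have h := congr($hT (toLinAlgEquiv' A))
  rw [AlgEquiv.trans_apply, AlgEquiv.trans_apply, AlgEquiv.symm_apply_apply] at h
  apply toLinAlgEquiv'.injective
  rw [h, map_mul, map_mul]
  refine LinearMap.ext fun v => ?_
  have e1 : toLinAlgEquiv' ((Units.map (toLinAlgEquiv' (R := k) (n := ι)).symm.toMonoidHom
    (LinearMap.GeneralLinearGroup.ofLinearEquiv T) : (Matrix ι ι k)ˣ) : Matrix ι ι k) =
      (T : (ι → k) →ₗ[k] ι → k) := toLinAlgEquiv'.apply_symm_apply _
  have e2 : toLinAlgEquiv' (((Units.map (toLinAlgEquiv' (R := k) (n := ι)).symm.toMonoidHom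
    (LinearMap.GeneralLinearGroup.ofLinearEquiv T))⁻¹ : (Matrix ι ι k)ˣ) : Matrix ι ι k) =
      (T.symm : (ι → k) →ₗ[k] ι → k) := toLinAlgEquiv'.apply_symm_apply _
  rw [e1, e2]
  rfl

end MatrixAlgebra

/-! ### Multiplicative families of matrix functions and their normal form. -/

section CoefficientSystem

variable {k G ι : Type*} [Field k] [Group G]

/-- Every matrix occurs as a value of some function in `S g` at every point. -/
def IsFull (S : G → Submodule k (G → Matrix ι ι k)) : Prop :=
  ∀ g x X, ∃ A ∈ S g, A x = X

/-- Two points are linked if evaluations of `S 1` at them have the same kernel. -/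
def Linked (S : G → Submodule k (G → Matrix ι ι k)) (x y : G) : Prop :=
  ∀ A ∈ S 1, A x = 0 ↔ A y = 0

variable {S : G → Submodule k (G → Matrix ι ι k)}

theorem Linked.refl (x : G) : Linked S x x := fun _ _ => Iff.rfl

theorem Linked.symm {x y : G} (h : Linked S x y) : Linked S y x := fun A hA => (h A hA).symm

theorem Linked.trans {x y z : G} (h : Linked S x y) (h' : Linked S y z) : Linked S x z :=
  fun A hA => (h A hA).trans (h' A hA)

variable [Fintype ι]

/-- A family `S g`, `g ∈ G`, of spaces of matrix-valued functions on `G` is multiplicative if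
it is closed under the twisted product `(A, B) ↦ (x ↦ A(x) B(g x))`, `A ∈ S g`. -/
def IsMultiplicative (S : G → Submodule k (G → Matrix ι ι k)) : Prop :=
  ∀ g h, ∀ A ∈ S g, ∀ B ∈ S h, (fun x => A x * B (g * x)) ∈ S (h * g)

theorem IsMultiplicative.mul_one_left (hS : IsMultiplicative S) {g : G}
    {A B : G → Matrix ι ι k} (hA : A ∈ S 1) (hB : B ∈ S g) : A * B ∈ S g := by
  have h := hS 1 g A hA B hB
  simpa only [one_mul, mul_one] using! h

theorem IsMultiplicative.mul_one_right (hS : IsMultiplicative S) {g : G}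
    {A B : G → Matrix ι ι k} (hA : A ∈ S g) (hB : B ∈ S 1) :
    (fun x => A x * B (g * x)) ∈ S g := by
  simpa only [one_mul] using hS g 1 A hA B hB

theorem IsMultiplicative.mul_inv (hS : IsMultiplicative S) {g : G}
    {A B : G → Matrix ι ι k} (hA : A ∈ S g) (hB : B ∈ S g⁻¹) :
    (fun x => A x * B (g * x)) ∈ S 1 := by
  simpa only [inv_mul_cancel] using hS g g⁻¹ A hA B hB

variable [DecidableEq ι]

/-- Irreducibility implies that all matrices occur as values. -/
theorem IsMultiplicative.isFull [IsAlgClosed k] (hS : IsMultiplicative S)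
    (h0 : ∃ g, S g ≠ ⊥)
    (hirr : ∀ N : G → Submodule k (ι → k),
      (∀ g, ∀ A ∈ S g, ∀ x, ∀ v ∈ N (g * x), A x *ᵥ v ∈ N x) →
        (∀ x, N x = ⊥) ∨ ∀ x, N x = ⊤) : IsFull S := by
  obtain ⟨g₀, hg₀⟩ := h0
  obtain ⟨A₀, hA₀, hA₀'⟩ := (S g₀).ne_bot_iff.1 hg₀
  obtain ⟨x₀, hx₀⟩ : ∃ x, A₀ x ≠ 0 := by
    by_contra! h
    exact hA₀' (funext h)
  have hne : Nonempty ι := by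
    by_contra h
    rw [not_nonempty_iff] at h
    exact hx₀ (Subsingleton.elim _ _)
  let V : G → G → Submodule k (Matrix ι ι k) := fun g x => (S g).map (LinearMap.proj x)
  have hV : ∀ g h x, ∀ X ∈ V g x, ∀ Y ∈ V h (g * x), X * Y ∈ V (h * g) x := by
    rintro g h x _ ⟨A, hA, rfl⟩ _ ⟨B, hB, rfl⟩
    exact ⟨_, hS g h A hA B hB, rfl⟩
  -- Vectors killed by every operator leaving the fibre at `y` form an invariant family. It is not
  -- everything because `A₀ x₀ ≠ 0`, so it vanishes.
  have hker : ∀ y, ∀ v : ι → k, (∀ g x, g * x = y → ∀ X ∈ V g x, X *ᵥ v = 0) → v = 0 := by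
    let N : G → Submodule k (ι → k) := fun y =>
      { carrier := {v | ∀ g x, g * x = y → ∀ X ∈ V g x, X *ᵥ v = 0}
        add_mem' := fun {v w} hv hw g x h X hX => by
          rw [mulVec_add, hv g x h X hX, hw g x h X hX, add_zero]
        zero_mem' := fun g x h X hX => mulVec_zero X
        smul_mem' := fun c v hv g x h X hX => by
          rw [mulVec_smul, hv g x h X hX, smul_zero] }
    have hN := hirr N fun g A hA x v hv h z hz X hX => by
      rw [mulVec_mulVec]
      subst hz
      exact hv (g * h) z (mul_assoc _ _ _) _ (hV h g z X hX _ ⟨A, hA, rfl⟩)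
    rcases hN with hN | hN
    · intro y v hv
      have : v ∈ N y := hv
      rwa [hN y, Submodule.mem_bot] at this
    · refine absurd ?_ hx₀
      refine Matrix.ext_of_mulVec_single fun i => ?_
      have : Pi.single i 1 ∈ N (g₀ * x₀) := hN (g₀ * x₀) ▸ Submodule.mem_top
      exact (this g₀ x₀ rfl _ ⟨A₀, hA₀, rfl⟩).trans (zero_mulVec _).symm
  have htr : ∀ g x (v : ι → k), v ≠ 0 → ∀ w, ∃ X ∈ V g x, X *ᵥ v = w := by
    intro g x v hv
    -- The vector `v` sits in the fibre at `g * x`, and `g * x * z⁻¹` indexes the operators from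
    -- there to the fibre at `z`: this is the orbit of `v`.
    let N : G → Submodule k (ι → k) := fun z =>
      (V (g * x * z⁻¹) z).map ((mulVecBilin k k).flip v)
    have hN := hirr N fun h A hA z u hu => by
      obtain ⟨X, hX, rfl⟩ := hu
      refine ⟨A z * X, ?_, (mulVec_mulVec _ _ _).symm⟩
      have := hV h _ z _ ⟨A, hA, rfl⟩ X hX
      simpa [mul_assoc] using this
    rcases hN with hN | hN
    · refine absurd (hker (g * x) v fun h z hz X hX => ?_) hv
      have : X *ᵥ v ∈ N z := ⟨X, by rwa [← hz, mul_inv_cancel_right], rfl⟩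
      rwa [hN z, Submodule.mem_bot] at this
    · intro w
      have : w ∈ N x := hN x ▸ Submodule.mem_top
      obtain ⟨X, hX, rfl⟩ := this
      exact ⟨X, by rwa [mul_inv_cancel_right] at hX, rfl⟩
  have hone : ∀ x, V 1 x = ⊤ := fun x => eq_top_of_transitive _
    (fun X hX Y hY => by simpa using hV 1 1 x X hX Y (by rwa [one_mul])) (htr 1 x)
  have hall : ∀ g x, V g x = ⊤ := fun g x => by
    obtain ⟨X, hX, hX1⟩ := htr g x 1 one_ne_zero 1
    refine eq_top_of_two_sided _
      (fun Y A hA => by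
        simpa using hV 1 g x Y (hone x ▸ Submodule.mem_top) A (by rwa [one_mul]))
      (fun Y A hA => by
        simpa using hV g 1 x A hA Y (hone _ ▸ Submodule.mem_top)) hX ?_
    rintro rfl
    simp at hX1
  intro g x X
  obtain ⟨A, hA, h⟩ : X ∈ V g x := hall g x ▸ Submodule.mem_top
  exact ⟨A, hA, h⟩

/-- If `x` and `y` are linked, an element of `S g` vanishing at `x` vanishes at `y`. -/
theorem Linked.eq_zero (hS : IsMultiplicative S) (hf : IsFull S) {x y : G} (hxy : Linked S x y)
    {g : G} {A : G → Matrix ι ι k} (hA : A ∈ S g) (hx : A x = 0) : A y = 0 := by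
  -- Twisted multiplication by `D` moves `A` into `S 1` without changing its value at `y`.
  obtain ⟨D, hD, hD1⟩ := hf g⁻¹ (g * y) 1
  have h := (hxy _ (hS.mul_inv hA hD)).1 (by simp [hx])
  simpa [hD1] using h

/-- Twisted multiplication by `B ∈ S g` with `B y = 1` carries the value at `g * y` to the point
`y`, which reduces the claim to `Linked.eq_zero`. -/
theorem Linked.mul_left (hS : IsMultiplicative S) (hf : IsFull S) {x y : G}
    (hxy : Linked S x y) (g : G) : Linked S (g * x) (g * y) := by
  have key : ∀ x y, Linked S x y → ∀ A ∈ S 1, A (g * x) = 0 → A (g * y) = 0 := by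
    intro x y hxy A hA h
    obtain ⟨B, hB, hB1⟩ := hf g y 1
    have h' := hxy.eq_zero hS hf (hS.mul_one_right hB hA) (by simp [h])
    simpa [hB1] using h'
  exact fun A hA => ⟨key x y hxy A hA, key y x hxy.symm A hA⟩

variable (S) in
/-- The set of elements linked to `1` is a subgroup. -/
def linkSubgroup (hS : IsMultiplicative S) (hf : IsFull S) : Subgroup G where
  carrier := {h | Linked S 1 h}
  one_mem' := Linked.refl 1
  mul_mem' := fun {a b} ha hb => Linked.trans ha (by simpa using hb.mul_left hS hf a)
  inv_mem' := fun {a} ha => by simpa using! (Linked.mul_left hS hf ha a⁻¹).symm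

/-- Left translation by `x⁻¹` turns a linked pair `x, y` into the linked pair `1, x⁻¹ * y`. -/
theorem mk_eq_mk_iff_linked (hS : IsMultiplicative S) (hf : IsFull S) {x y : G} :
    (x : G ⧸ linkSubgroup S hS hf) = (y : G ⧸ linkSubgroup S hS hf) ↔ Linked S x y := by
  rw [QuotientGroup.eq]
  refine ⟨fun h => ?_, fun h => ?_⟩
  · simpa using Linked.mul_left hS hf h x
  · show Linked S 1 (x⁻¹ * y)
    simpa using h.mul_left hS hf x⁻¹

/-- If `x` and `y` are not linked, the evaluations of `S 1` at `x` and `y` separate. -/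
theorem exists_eq_one_eq_zero (hS : IsMultiplicative S) (hf : IsFull S) {x y : G}
    (hxy : ¬ Linked S x y) : ∃ E ∈ S 1, E x = 1 ∧ E y = 0 := by
  have key : ∀ x y, (∃ A ∈ S 1, A x = 0 ∧ A y ≠ 0) → ∃ E ∈ S 1, E y = 1 ∧ E x = 0 := by
    rintro x y ⟨A, hA, hx, hy⟩
    -- Values at `y` of elements vanishing at `x`: an ideal, because `S 1` takes all values at `y`.
    let I : Submodule k (Matrix ι ι k) :=
      (S 1 ⊓ LinearMap.ker (LinearMap.proj x)).map (LinearMap.proj y)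
    have hI : I = ⊤ := by
      refine eq_top_of_two_sided I ?_ ?_ (A := A y) ⟨A, ⟨hA, hx⟩, rfl⟩ hy
      · rintro X _ ⟨B, ⟨hB, hBx⟩, rfl⟩
        obtain ⟨D, hD, rfl⟩ := hf 1 y X
        refine ⟨D * B, ⟨hS.mul_one_left hD hB, ?_⟩, rfl⟩
        change B x = 0 at hBx
        simp [hBx]
      · rintro X _ ⟨B, ⟨hB, hBx⟩, rfl⟩
        obtain ⟨D, hD, rfl⟩ := hf 1 y X
        refine ⟨B * D, ⟨hS.mul_one_left hB hD, ?_⟩, rfl⟩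
        change B x = 0 at hBx
        simp [hBx]
    obtain ⟨E, ⟨hE, hEx⟩, hEy⟩ : (1 : Matrix ι ι k) ∈ I := hI ▸ Submodule.mem_top
    exact ⟨E, hE, hEy, hEx⟩
  simp only [Linked, not_forall] at hxy
  obtain ⟨A, hA, h⟩ := hxy
  by_cases hx : A x = 0
  · obtain ⟨E, hE, hEy, hEx⟩ := key x y ⟨A, hA, hx, fun hy => h (by simp [hx, hy])⟩
    obtain ⟨D, hD, hDx⟩ := hf 1 x 1
    -- A substitute for `1 - E`, as the constant 1 need not lie in `S 1`.
    refine ⟨D - D * E, (S 1).sub_mem hD (hS.mul_one_left hD hE), ?_, ?_⟩ <;> simp [hEx, hEy, hDx]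
  · exact key y x ⟨A, hA, by by_contra hy; exact h (by simp [hx, hy]), hx⟩

/-- The indicator function of a class of linked points belongs to `S 1`. -/
theorem exists_indicator [Finite G] (hS : IsMultiplicative S) (hf : IsFull S) (x : G) :
    ∃ E ∈ S 1, (∀ y, Linked S x y → E y = 1) ∧ ∀ y, ¬ Linked S x y → E y = 0 := by
  classical
  have := Fintype.ofFinite G
  have key : ∀ s : Finset G, (∀ y ∈ s, ¬ Linked S x y) →
      ∃ E ∈ S 1, E x = 1 ∧ ∀ y ∈ s, E y = 0 := by
    intro s
    induction s using Finset.induction_on with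
    | empty =>
      intro _
      obtain ⟨E, hE, h1⟩ := hf 1 x 1
      exact ⟨E, hE, h1, by simp⟩
    | insert a s _ ih =>
      intro h
      obtain ⟨E, hE, h1, h2⟩ := ih fun y hy => h y (Finset.mem_insert_of_mem hy)
      obtain ⟨F, hF, h3, h4⟩ := exists_eq_one_eq_zero hS hf (h a (Finset.mem_insert_self a s))
      refine ⟨E * F, hS.mul_one_left hE hF, by simp [h1, h3], fun y hy => ?_⟩
      rcases Finset.mem_insert.1 hy with rfl | hy
      · simp [h4]
      · simp [h2 y hy]
  obtain ⟨E, hE, h1, h2⟩ := key (Finset.univ.filter fun y => ¬ Linked S x y) (by simp)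
  refine ⟨E, hE, fun y hy => ?_, fun y hy => h2 y (by simpa using hy)⟩
  -- `E * D - D` vanishes at `x`, hence at the linked point `y`, where it equals `E y - 1`.
  obtain ⟨D, hD, hD1⟩ := hf 1 y 1
  have h := (hy _ ((S 1).sub_mem (hS.mul_one_left hE hD) hD)).1 (by simp [h1])
  simpa [hD1, sub_eq_zero] using h

/-- Evaluations of `S 1` at linked points are conjugate. -/
theorem Linked.exists_conj (hS : IsMultiplicative S) (hf : IsFull S) {x y : G}
    (hxy : Linked S x y) :
    ∃ P : (Matrix ι ι k)ˣ, ∀ A ∈ S 1, A y = P * A x * (P⁻¹ : (Matrix ι ι k)ˣ) := by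
  -- Equality of kernels makes the value at `y` a function of the value at `x`; this function is the
  -- automorphism `φ`.
  choose D hD hDx using hf 1 x
  have key : ∀ A ∈ S 1, ∀ B ∈ S 1, A x = B x → A y = B y := fun A hA B hB h => by
    have := (hxy _ ((S 1).sub_mem hA hB)).1 (by simp [h])
    simpa [sub_eq_zero] using this
  let φ : Matrix ι ι k →ₗ[k] Matrix ι ι k :=
    { toFun := fun X => D X y
      map_add' := fun X Y =>
        key _ (hD _) (D X + D Y) ((S 1).add_mem (hD X) (hD Y)) (by simp [hDx])
      map_smul' := fun c X =>
        key _ (hD _) (c • D X) ((S 1).smul_mem c (hD X)) (by simp [hDx]) }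
  have hφmul : ∀ X Y, φ (X * Y) = φ X * φ Y := fun X Y =>
    key _ (hD _) (D X * D Y) (hS.mul_one_left (hD X) (hD Y)) (by simp [hDx])
  have hsurj : Function.Surjective φ := fun X => by
    obtain ⟨A, hA, rfl⟩ := hf 1 y X
    exact ⟨A x, key _ (hD _) A hA (hDx _)⟩
  have hinj : Function.Injective φ := LinearMap.ker_eq_bot.1 <| LinearMap.ker_eq_bot'.2
    fun X hX => by rw [← hDx X]; exact (hxy _ (hD X)).2 hX
  have hφone : φ 1 = 1 := by
    obtain ⟨X, hX⟩ := hsurj 1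
    have h := hφmul X 1
    rwa [mul_one, hX, one_mul, eq_comm] at h
  obtain ⟨P, hP⟩ := exists_unit_conj
    (AlgEquiv.ofBijective (AlgHom.ofLinearMap φ hφone hφmul) ⟨hinj, hsurj⟩)
  refine ⟨P, fun A hA => ?_⟩
  rw [← hP (A x)]
  exact key A hA _ (hD _) (hDx _).symm

/-- If `S 1` consists of functions that are constant on classes of linked points, then the values
of elements of `S g` at linked points are proportional. -/
theorem Linked.exists_scalar [Nonempty ι] (hS : IsMultiplicative S) (hf : IsFull S)
    (hc : ∀ A ∈ S 1, ∀ x y, Linked S x y → A x = A y) {x y : G} (hxy : Linked S x y) (g : G) :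
    ∃ c : kˣ, ∀ A ∈ S g, A y = (c : k) • A x := by
  -- Multiplying `Z` by `S 1` on either side reproduces any `A ∈ S g`, so `A y` is both `A x * Z y`
  -- and `Z y * A x`. Thus `Z y` is central, and it is the required scalar.
  obtain ⟨Z, hZ, hZx⟩ := hf g x 1
  have key : ∀ A ∈ S g, ∀ B ∈ S g, A x = B x → A y = B y := fun A hA B hB h => by
    have := hxy.eq_zero hS hf ((S g).sub_mem hA hB) (by simp [h])
    simpa [sub_eq_zero] using this
  have hleft : ∀ A ∈ S g, A y = A x * Z y := fun A hA => by
    obtain ⟨B, hB, hBx⟩ := hf 1 x (A x)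
    rw [key A hA _ (hS.mul_one_left hB hZ) (by simp [hBx, hZx]), Pi.mul_apply,
      ← hc B hB x y hxy, hBx]
  have hright : ∀ A ∈ S g, A y = Z y * A x := fun A hA => by
    obtain ⟨B, hB, hBx⟩ := hf 1 (g * x) (A x)
    rw [key A hA _ (hS.mul_one_right hZ hB) (by simp [hBx, hZx]),
      ← hc B hB _ _ (hxy.mul_left hS hf g), hBx]
  obtain ⟨c, hcZ⟩ : Z y ∈ Set.range (Matrix.scalar ι) :=
    mem_range_scalar_of_commute_single fun i j _ => by
      obtain ⟨A, hA, hAx⟩ := hf g x (Matrix.single i j 1)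
      have h := (hleft A hA).symm.trans (hright A hA)
      rwa [hAx] at h
  have hy : ∀ A ∈ S g, A y = c • A x := fun A hA => by
    rw [hright A hA, ← hcZ, Matrix.scalar_apply, ← Matrix.smul_one_eq_diagonal, smul_mul_assoc,
      one_mul]
  have hc0 : c ≠ 0 := by
    rintro rfl
    obtain ⟨A, hA, hAy⟩ := hf g y 1
    have h := hy A hA
    rw [hAy, zero_smul] at h
    exact one_ne_zero h
  exact ⟨Units.mk0 c hc0, hy⟩

/-- A full multiplicative family whose component `S 1` is constant on classes of linked points is
given by a subgroup and a function `χ` satisfying the coset cocycle condition. -/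
theorem exists_coset_description [Finite G] [Nonempty ι] (hS : IsMultiplicative S)
    (hf : IsFull S) (hc : ∀ A ∈ S 1, ∀ x y, Linked S x y → A x = A y) :
    ∃ (G₁ : Subgroup G) (χ : G → G → kˣ), CosetCocycle G₁ χ ∧
      ∀ (g : G) (A : G → Matrix ι ι k), A ∈ S g⁻¹ ↔
        ∃ a : G ⧸ G₁ → Matrix ι ι k, ∀ x : G, A x = (χ g x : k) • a x := by
  classical
  have := Fintype.ofFinite (G ⧸ linkSubgroup S hS hf)
  have hrep : ∀ x : G, Linked S (x : G ⧸ linkSubgroup S hS hf).out x := fun x =>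
    (mk_eq_mk_iff_linked hS hf).1 (QuotientGroup.out_eq' _)
  -- The inverse appears because `T_g ⊗ f ⊗ A` is supported on the operator at `g⁻¹`.
  choose χ hχ using fun (g x : G) => (hrep x).exists_scalar hS hf hc g⁻¹
  have hmem : ∀ (g : G) (A : G → Matrix ι ι k), A ∈ S g⁻¹ ↔
      ∃ a : G ⧸ linkSubgroup S hS hf → Matrix ι ι k, ∀ x : G, A x = (χ g x : k) • a x := by
    refine fun g A => ⟨fun hA => ⟨fun K => A K.out, fun x => hχ g x A hA⟩, ?_⟩
    rintro ⟨a, ha⟩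
    -- Conversely, `A` is glued from elements with the right value at each representative, cut off
    -- by coset indicators.
    choose E hE hE1 hE0 using fun K : G ⧸ linkSubgroup S hS hf => exists_indicator hS hf K.out
    choose B hB hBa using fun K : G ⧸ linkSubgroup S hS hf => hf g⁻¹ K.out (a K)
    have hsum : A = ∑ K, E K * B K := by
      funext x
      rw [Finset.sum_apply, Finset.sum_eq_single (x : G ⧸ linkSubgroup S hS hf)]
      · rw [Pi.mul_apply, hE1 _ _ (hrep x), one_mul, hχ g x _ (hB _), hBa, ha]
      · intro K _ hK
        rw [Pi.mul_apply, hE0 K x, zero_mul]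
        intro h
        apply hK
        rw [← (mk_eq_mk_iff_linked hS hf).2 h, QuotientGroup.out_eq']
      · simp
    rw [hsum]
    exact (S g⁻¹).sum_mem fun K _ => hS.mul_one_left (hE K) (hB K)
  refine ⟨linkSubgroup S hS hf, χ, ?_, hmem⟩
  intro g h γ γ' hγ
  -- The twisted product of `χ(g,·)1` and `χ(h,·)1` lies in `S (g * h)⁻¹`, hence is `χ(gh,·)` times
  -- a function of the coset.
  have hA := (hmem g fun x => (χ g x : k) • 1).2 ⟨fun _ => 1, fun _ => rfl⟩
  have hB := (hmem h fun x => (χ h x : k) • 1).2 ⟨fun _ => 1, fun _ => rfl⟩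
  have hAB := hS _ _ _ hA _ hB
  rw [← _root_.mul_inv_rev] at hAB
  obtain ⟨a, ha⟩ := (hmem (g * h) _).1 hAB
  have hval : ∀ x : G, ((χ g x * χ h (g⁻¹ * x) / χ (g * h) x : kˣ) : k) • (1 : Matrix ι ι k) =
      a x := fun x => by
    have h1 := ha x
    rw [smul_mul_smul_comm, one_mul] at h1
    rw [div_eq_inv_mul, Units.val_mul, mul_smul, Units.val_mul, h1, smul_smul, Units.inv_mul,
      one_smul]
  have heq := (hval γ).trans ((congrArg a hγ).trans (hval γ').symm)
  exact Units.ext (smul_left_injective k (one_ne_zero (α := Matrix ι ι k)) heq)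

/-- The family obtained from `S` by the gauge transformation `A(x) ↦ Q(x) A(x) Q(g x)⁻¹`. -/
def gauge (Q : G → (Matrix ι ι k)ˣ) (S : G → Submodule k (G → Matrix ι ι k)) (g : G) :
    Submodule k (G → Matrix ι ι k) :=
  (S g).map (LinearMap.pi fun x => LinearMap.mulLeftRight k
    ((Q x : Matrix ι ι k), (((Q (g * x))⁻¹ : (Matrix ι ι k)ˣ) : Matrix ι ι k)) ∘ₗ
      LinearMap.proj x)

theorem mem_gauge {Q : G → (Matrix ι ι k)ˣ} {g : G} {A : G → Matrix ι ι k} :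
    A ∈ gauge Q S g ↔ ∃ B ∈ S g, (fun x => (Q x : Matrix ι ι k) * B x *
      (((Q (g * x))⁻¹ : (Matrix ι ι k)ˣ) : Matrix ι ι k)) = A := Iff.rfl

theorem IsMultiplicative.gauge (hS : IsMultiplicative S) (Q : G → (Matrix ι ι k)ˣ) :
    IsMultiplicative (gauge Q S) := by
  rintro g h _ ⟨A, hA, rfl⟩ _ ⟨B, hB, rfl⟩
  refine ⟨_, hS g h A hA B hB, funext fun x => ?_⟩
  simp [mul_assoc]

theorem IsFull.gauge (hf : IsFull S) (Q : G → (Matrix ι ι k)ˣ) : IsFull (gauge Q S) := by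
  intro g x X
  obtain ⟨A, hA, hAx⟩ := hf g x (((Q x)⁻¹ : (Matrix ι ι k)ˣ) * X * Q (g * x))
  refine ⟨_, ⟨A, hA, rfl⟩, ?_⟩
  simp [hAx, mul_assoc]

/-- Multiplication by invertible matrices does not change where a function vanishes. -/
theorem Linked.of_gauge {Q : G → (Matrix ι ι k)ˣ} {x y : G} (h : Linked (gauge Q S) x y) :
    Linked S x y := fun A hA => by
  have hzero := h _ (mem_gauge.2 ⟨A, hA, rfl⟩)
  rwa [Units.mul_left_eq_zero, Units.mul_left_eq_zero, Units.mul_right_eq_zero,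
    Units.mul_right_eq_zero] at hzero

/-- After a gauge transformation, a full multiplicative family is given by a subgroup and a
function `χ` satisfying the coset cocycle condition. -/
theorem exists_gauge_coset_description [Finite G] [Nonempty ι] (hS : IsMultiplicative S)
    (hf : IsFull S) :
    ∃ (Q : G → (Matrix ι ι k)ˣ) (G₁ : Subgroup G) (χ : G → G → kˣ), CosetCocycle G₁ χ ∧
      ∀ (g : G) (A : G → Matrix ι ι k), A ∈ gauge Q S g⁻¹ ↔
        ∃ a : G ⧸ G₁ → Matrix ι ι k, ∀ x : G, A x = (χ g x : k) • a x := by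
  have hrep : ∀ x : G, Linked S (x : G ⧸ linkSubgroup S hS hf).out x := fun x =>
    (mk_eq_mk_iff_linked hS hf).1 (QuotientGroup.out_eq' _)
  choose P hP using fun x => (hrep x).exists_conj hS hf
  -- Undoing the conjugation by `P x` replaces the value at `x` by the value at the representative
  -- of its coset.
  refine ⟨fun x => (P x)⁻¹, exists_coset_description (hS.gauge _) (hf.gauge _) ?_⟩
  intro A hA x y hxy
  obtain ⟨B, hB, rfl⟩ := mem_gauge.1 hA
  have key : ∀ x : G, (((P x)⁻¹ : (Matrix ι ι k)ˣ) : Matrix ι ι k) * B x *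
      (((P (1 * x))⁻¹⁻¹ : (Matrix ι ι k)ˣ) : Matrix ι ι k) =
        B (x : G ⧸ linkSubgroup S hS hf).out := fun x => by
    rw [hP x B hB, one_mul, inv_inv, mul_assoc, mul_assoc, Units.inv_mul, mul_one,
      Units.inv_mul_cancel_left]
  change _ * _ * _ = _ * _ * _
  rw [key x, key y, (mk_eq_mk_iff_linked hS hf).2 hxy.of_gauge]

end CoefficientSystem

/-! ### Passage between `Cend_n` and coefficient families. -/

section Coordinates

variable {k G : Type*} [Field k] [Group G] {n : ℕ}

namespace Cend

/-- The matrix-valued functions `x ↦ A_g(x)` with `(a(g) u)(x) = A_g(x) u(g x)`. -/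
def coef (g : G) : Cend k G n →ₗ[k] G → Matrix (Fin n) (Fin n) k where
  toFun a x := Matrix.of fun i j => a.op g (Pi.single j 1) i x
  map_add' _ _ := rfl
  map_smul' _ _ := rfl

/-- Expand `u` in the standard `H`-basis; translation invariance pulls the coordinates out as left
shifts. -/
theorem op_apply (a : Cend k G n) (g : G) (u : FreeMod k G n) (x : G) :
    (fun i => a.op g u i x) = coef g a x *ᵥ fun j => u j (g * x) := by
  have hu : u = ∑ j, u j • (Pi.single j 1 : FreeMod k G n) := by
    funext i
    rw [Finset.sum_apply, Finset.sum_eq_single i] <;> simp +contextual [eq_comm]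
  funext i
  conv_lhs => rw [hu]
  simp only [map_sum, op_tinv, Finset.sum_apply, Pi.smul_apply, smul_eq_mul, Pi.mul_apply,
    leftShift, mulVec, dotProduct, coef]
  exact Finset.sum_congr rfl fun j _ => mul_comm _ _

theorem ext_coef {a b : Cend k G n} (h : ∀ g x, coef g a x = coef g b x) : a = b :=
  ext_op fun g u => by
    funext i x
    have e := (op_apply a g u x).trans (h g x ▸ (op_apply b g u x).symm)
    exact congrFun e i

variable [Finite G]

/-- The conformal endomorphism with prescribed coefficients. -/
def ofCoef (A : G → G → Matrix (Fin n) (Fin n) k) : Cend k G n :=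
  mk (fun g =>
    { toFun := fun u i x => (A g x *ᵥ fun j => u j (g * x)) i
      map_add' := fun u v => by
        funext i x
        exact congrFun (mulVec_add (A g x) (fun j => u j (g * x)) fun j => v j (g * x)) i
      map_smul' := fun c u => by
        funext i x
        exact congrFun (mulVec_smul (A g x) c fun j => u j (g * x)) i })
    fun g f u => by
      funext i x
      exact congrFun (mulVec_smul (A g x) (f (g * x)) fun j => u j (g * x)) i

theorem coef_ofCoef (A : G → G → Matrix (Fin n) (Fin n) k) (g : G) :
    coef g (ofCoef A) = A g := by
  funext x
  refine Matrix.ext_of_mulVec_single fun i => ?_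
  have h := op_apply (ofCoef A) g (Pi.single i 1) x
  have e : (fun j => (Pi.single i 1 : FreeMod k G n) j (g * x)) = Pi.single i 1 := by
    funext j
    by_cases hj : j = i
    · subst hj; simp
    · simp [hj]
  rw [e] at h
  rw [← h, ← e]
  rfl

theorem coef_hsmul (f : H k G) (a : Cend k G n) (g : G) :
    coef g (f • a) = f g⁻¹ • coef g a := rfl

theorem coef_prod (g : G) (a b : Cend k G n) (z x : G) :
    coef z (ConformalAlgebra.prod (k := k) g a b) x = coef g a x * coef (z * g⁻¹) b (g * x) := by
  refine Matrix.ext_of_mulVec_single fun i => ?_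
  rw [← mulVec_mulVec]
  funext l
  have h := congrFun (op_apply a g (b.op (z * g⁻¹) (Pi.single i 1)) x) l
  have h' : (fun j => b.op (z * g⁻¹) (Pi.single i 1) j (g * x)) =
      coef (z * g⁻¹) b (g * x) *ᵥ Pi.single i 1 := by
    rw [mulVec_single_one]
    rfl
  rw [← h', mulVec_single_one]
  exact h

theorem coef_tmul (h f : H k G) (A : Matrix (Fin n) (Fin n) k) (g x : G) :
    coef g (tmul h f A) x = (h g⁻¹ * f x) • A := by
  have e : tmul h f A = ofCoef fun g x => (h g⁻¹ * f x) • A := ext_op fun g u => by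
    funext i x
    change _ = (((h g⁻¹ * f x) • A) *ᵥ fun j => u j (g * x)) i
    rw [smul_mulVec]
    rfl
  rw [e, coef_ofCoef]

/-- The automorphism `A_g(x) ↦ Q(x) A_g(x) Q(g x)⁻¹` of `Cend_n`. -/
def gaugeAut (Q : G → (Matrix (Fin n) (Fin n) k)ˣ) : ConformalAut k G (Cend k G n) where
  toFun a := ofCoef fun g x => (Q x : Matrix (Fin n) (Fin n) k) * coef g a x *
    (((Q (g * x))⁻¹ : (Matrix (Fin n) (Fin n) k)ˣ) : Matrix (Fin n) (Fin n) k)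
  invFun a := ofCoef fun g x => (((Q x)⁻¹ : (Matrix (Fin n) (Fin n) k)ˣ) : Matrix _ _ k) *
    coef g a x * (Q (g * x) : Matrix (Fin n) (Fin n) k)
  map_add' a b := ext_coef fun g x => by
    simp only [map_add, coef_ofCoef, Pi.add_apply, mul_add, add_mul]
  map_smul' f a := ext_coef fun g x => by
    simp only [coef_hsmul, coef_ofCoef, Pi.smul_apply, mul_smul_comm, smul_mul_assoc,
      RingHom.id_apply]
  left_inv a := ext_coef fun g x => by
    simp only [coef_ofCoef, mul_assoc, Units.inv_mul, mul_one, Units.inv_mul_cancel_left]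
  right_inv a := ext_coef fun g x => by
    simp only [coef_ofCoef, mul_assoc, Units.mul_inv, mul_one, Units.mul_inv_cancel_left]
  map_prod g a b := ext_coef fun z x => by
    change coef z (ofCoef _) x =
      coef z (ConformalAlgebra.prod (k := k) g (ofCoef _) (ofCoef _)) x
    simp only [coef_ofCoef, coef_prod, mul_assoc, Units.inv_mul_cancel_left, inv_mul_cancel_left]

theorem coef_gaugeAut (Q : G → (Matrix (Fin n) (Fin n) k)ˣ) (a : Cend k G n) (g x : G) :
    coef g ((gaugeAut Q).toLinearEquiv a) x = (Q x : Matrix (Fin n) (Fin n) k) * coef g a x *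
      (((Q (g * x))⁻¹ : (Matrix (Fin n) (Fin n) k)ˣ) : Matrix (Fin n) (Fin n) k) :=
  congrFun (coef_ofCoef _ g) x

end Cend

variable [Finite G]

/-- The coefficients of the operators `a(g)`, `a ∈ C`. -/
def coefSpace (C : ConformalSubalgebra k G (Cend k G n)) (g : G) :
    Submodule k (G → Matrix (Fin n) (Fin n) k) :=
  (C.toSubmodule.restrictScalars k).map (Cend.coef g)

/-- An element of `Cend_n` belongs to `C` as soon as each of its operators is an operator of
some element of `C`. -/
theorem mem_of_forall_coef_mem (C : ConformalSubalgebra k G (Cend k G n)) {a : Cend k G n}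
    (h : ∀ g, Cend.coef g a ∈ coefSpace C g) : a ∈ C.toSubmodule := by
  classical
  have := Fintype.ofFinite G
  choose b hb hba using h
  -- Since `(fa)(z) = f(z⁻¹)a(z)`, the indicator of `g⁻¹` keeps only the operator at `g`.
  have e : a = ∑ g : G, (Pi.single g⁻¹ 1 : H k G) • b g := Cend.ext_coef fun z x => by
    rw [map_sum, Finset.sum_apply, Finset.sum_eq_single z]
    · rw [Cend.coef_hsmul, Pi.single_eq_same, one_smul, hba]
    · intro g _ hg
      rw [Cend.coef_hsmul, Pi.single_eq_of_ne (by simpa using hg.symm), zero_smul, Pi.zero_apply]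
    · simp
  rw [e]
  exact C.toSubmodule.sum_mem fun g _ => C.toSubmodule.smul_mem _ (hb g)

/-- Evaluate `a ∘_g b` at `z = h * g`, where the second factor becomes `b(h)`. -/
theorem isMultiplicative_coefSpace (C : ConformalSubalgebra k G (Cend k G n)) :
    IsMultiplicative (coefSpace C) := by
  rintro g h _ ⟨a, ha, rfl⟩ _ ⟨b, hb, rfl⟩
  refine ⟨_, C.prod_mem g ha hb, funext fun x => ?_⟩
  rw [Cend.coef_prod, mul_inv_cancel_right]

theorem exists_coefSpace_ne_bot (C : ConformalSubalgebra k G (Cend k G n))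
    (hC : C.toSubmodule ≠ ⊥) : ∃ g, coefSpace C g ≠ ⊥ := by
  by_contra! h
  refine hC ((Submodule.eq_bot_iff _).2 fun a ha => Cend.ext_coef fun g x => ?_)
  have hmem : Cend.coef g a ∈ coefSpace C g := ⟨a, ha, rfl⟩
  rw [h g, Submodule.mem_bot] at hmem
  rw [hmem, map_zero]

/-- Irreducibility in coordinates: there are no nontrivial invariant families of subspaces. -/
theorem IsIrreducible.invariant_family {C : ConformalSubalgebra k G (Cend k G n)}
    (hC : IsIrreducible C) (N : G → Submodule k (Fin n → k))
    (hN : ∀ g, ∀ A ∈ coefSpace C g, ∀ x, ∀ v ∈ N (g * x), A x *ᵥ v ∈ N x) :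
    (∀ x, N x = ⊥) ∨ ∀ x, N x = ⊤ := by
  classical
  let M : Submodule (H k G) (FreeMod k G n) :=
    { carrier := {u | ∀ x, (fun i => u i x) ∈ N x}
      add_mem' := fun hu hv x => (N x).add_mem (hu x) (hv x)
      zero_mem' := fun x => (N x).zero_mem
      smul_mem' := fun f u hu x => (N x).smul_mem (f x) (hu x) }
  have hM : ∀ w ∈ operatorSpan C, ∀ u ∈ M, w u ∈ M := fun w hw => by
    induction hw using Submodule.span_induction with
    | mem w hw =>
      obtain ⟨a, ha, g, rfl⟩ := hw
      intro u hu x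
      rw [Cend.op_apply]
      exact hN g _ ⟨a, ha, rfl⟩ x _ (hu (g * x))
    | zero => exact fun u _ => M.zero_mem
    | add w w' _ _ h h' => exact fun u hu => M.add_mem (h u hu) (h' u hu)
    | smul c w _ h => exact fun u hu x => (N x).smul_mem c (h u hu x)
  -- Functions supported at one point recover each fibre `N x` from `M`.
  have hsingle : ∀ x, ∀ v : Fin n → k, v ∈ N x → (fun i => Pi.single x (v i)) ∈ M := by
    intro x v hv y
    by_cases hy : y = x
    · subst hy; simpa using hv
    · have h0 : (fun i => (Pi.single x (v i) : H k G) y) = 0 := by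
        funext i
        simp [hy]
      exact h0 ▸ (N y).zero_mem
  rcases hC.2 M hM with h | h
  · refine Or.inl fun x => (Submodule.eq_bot_iff _).2 fun v hv => ?_
    have h0 := hsingle x v hv
    rw [h, Submodule.mem_bot] at h0
    funext i
    simpa using congrFun (congrFun h0 i) x
  · refine Or.inr fun x => eq_top_iff.2 fun v _ => ?_
    have hv : (fun i _ => v i : FreeMod k G n) ∈ M := h ▸ Submodule.mem_top
    exact hv x

/-- The coefficient of `T_g ⊗ T_α ⊗ A` lives only at the operator index `g⁻¹` and the point `α`, so
a single term of the double sum survives. -/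
theorem mem_cosetAlgebra [Fintype G] [DecidableEq G] {G₁ : Subgroup G} {χ : G → G → kˣ}
    {x : Cend k G n} : x ∈ cosetAlgebra G₁ χ ↔
      ∀ g, ∃ a : G ⧸ G₁ → Matrix (Fin n) (Fin n) k, ∀ α : G,
        Cend.coef g⁻¹ x α = (χ g α : k) • a α := by
  have key : ∀ (a : G → G ⧸ G₁ → Matrix (Fin n) (Fin n) k) (g α : G),
      Cend.coef g⁻¹ (∑ g : G, ∑ α : G,
        Cend.tmul (Pi.single g 1) (Pi.single α 1) ((χ g α : k) • a g (α : G ⧸ G₁))) α =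
      (χ g α : k) • a g α := fun a g α => by
    simp only [map_sum, Finset.sum_apply, Cend.coef_tmul, inv_inv]
    rw [Finset.sum_eq_single g, Finset.sum_eq_single α] <;>
      simp +contextual [Pi.single_apply, eq_comm]
  constructor
  · rintro ⟨a, rfl⟩ g
    exact ⟨a g, key a g⟩
  · intro h
    choose a ha using h
    refine ⟨a, Cend.ext_coef fun g α => ?_⟩
    rw [← inv_inv g, ha, key]

end Coordinates

end FiniteConformal

open FiniteConformal in
theorem mainTheorem2 {k G : Type*} [Field k] [IsAlgClosed k] [Group G] [Fintype G]
    [DecidableEq G] (n : ℕ) (C : ConformalSubalgebra k G (Cend k G n)) (hC : IsIrreducible C) :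
    ∃ (θ : ConformalAut k G (Cend k G n)) (G₁ : Subgroup G) (χ : G → G → kˣ),
      CosetCocycle G₁ χ ∧
      θ.toLinearEquiv '' (C.toSubmodule : Set (Cend k G n)) = cosetAlgebra G₁ χ := by
  have hS := isMultiplicative_coefSpace C
  have h0 := exists_coefSpace_ne_bot C hC.1
  have hf : IsFull (coefSpace C) := hS.isFull h0 hC.invariant_family
  -- For `n = 0` all coefficient spaces are zero, contradicting `C ≠ 0`.
  have hne : Nonempty (Fin n) := by
    obtain ⟨g, hg⟩ := h0
    by_contra h
    rw [not_nonempty_iff] at h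
    exact hg (Subsingleton.elim _ _)
  obtain ⟨Q, G₁, χ, hχ, hmem⟩ := exists_gauge_coset_description hS hf
  refine ⟨Cend.gaugeAut Q, G₁, χ, hχ, Set.ext fun b => ?_⟩
  rw [mem_cosetAlgebra]
  constructor
  · rintro ⟨a, ha, rfl⟩ g
    exact (hmem g _).1 (mem_gauge.2 ⟨_, ⟨a, ha, rfl⟩,
      funext fun x => (Cend.coef_gaugeAut Q a g⁻¹ x).symm⟩)
  · intro hb
    obtain ⟨a, rfl⟩ := (Cend.gaugeAut Q).toLinearEquiv.surjective b
    refine ⟨a, mem_of_forall_coef_mem C fun g => ?_, rfl⟩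
    obtain ⟨B, hB, hBa⟩ := mem_gauge.1 ((hmem g⁻¹ _).2 (hb g⁻¹))
    rw [inv_inv] at hB hBa
    have e : B = Cend.coef g a := funext fun x => by
      have hx := congrFun hBa x
      simpa only [Cend.coef_gaugeAut, Units.mul_left_inj, Units.mul_right_inj] using hx
    exact e ▸ hB
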